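/- Let $k$ be a field and $n\ge 1$ an integer. Let $\operatorname{Int}([n-1])$ be the set of nonempty intervals $[a,b]$, $a\le b$, of a totally ordered set with $n-1$ elements, ordered by containment, and let $A$ be the incidence algebra over $k$ of the opposite poset $P=(\operatorname{Int}([n-1]),\subseteq)^{op}$, that is, the algebra of functions $f:P\times P\to k$ with $f(x,y)=0$ unless $x\le_P y$, with product $(fg)(x,y)=\sum_{x\le_P z\le_P y}f(x,z)g(z,y)$. Let $\operatorname{mod}A$ be the category of finitely generated right $A$-modules. An $\omega$-torsion pair of $\operatorname{mod}A$ is a pair $(\mathcal T,\mathcal F)$ of full subcategories closed under isomorphisms such that 1. $\operatorname{Hom}_A(T,F)=0$ for all $T\in\mathcal T$, $F\in\mathcal F$; 2. for every $X\in\operatorname{mod}A$ there is a short exact sequence $0\to tX\to X\to fX\to 0$ with $tX\in\mathcal T$ and $fX\in\mathcal F$; 3. $\operatorname{Ext}^1_A(T,F)=0$ for all $T\in\mathcal T$, $F\in\mathcal F$. Order the $\omega$-torsion pairs by $(\mathcal T,\mathcal F)\le(\mathcal T',\mathcal F')$ if and only if $\mathcal T\subseteq\mathcal T'$ and $\mathcal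 F'\subseteq\mathcal F$. Order the Dyck paths of length $n$ (with $n$ up-steps and $n$ down-steps, never going below their starting height) by $p\le q$ if and only if $p$ lies weakly below $q$, i.e. after every number of steps the height of $p$ is at most that of $q$. Then both posets are lattices, and they are isomorphic. -/

import Mathlib

open CategoryTheory

universe u

/-- A partial order is a lattice: any two elements have a least upper bound and a greatest
lower bound. -/
def IsLatticeOrder (α : Type*) [PartialOrder α] : Prop :=
  ∀ x y : α, (∃ s, IsLUB {x, y} s) ∧ (∃ i, IsGLB {x, y} i)

/-- A Dyck path of length `n`: a Dyck word with `n` up-steps and `n` down-steps.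
(A structure and not a subtype, since Mathlib orders `DyckWord` by nesting of subwords, which is
not the order of the lattice of Dyck paths.) -/
@[ext]
structure DyckPath (n : ℕ) where
  /-- The sequence of steps. -/
  word : DyckWord
  /-- There are `n` up-steps (hence `n` down-steps). -/
  semilength_eq : word.semilength = n

namespace DyckPath

variable {n : ℕ}

/-- The height of a Dyck path after its first `i` steps. -/
def height (p : DyckPath n) (i : ℕ) : ℤ :=
  ((p.word.toList.take i).count DyckStep.U : ℤ) - ((p.word.toList.take i).count DyckStep.D : ℤ)

/-- `p ≤ q` means that the path `p` lies (weakly) below the path `q`. -/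
instance : LE (DyckPath n) := ⟨fun p q => ∀ i, p.height i ≤ q.height i⟩

theorem list_ext_of_height : ∀ l m : List DyckStep, l.length = m.length →
    (∀ i, ((l.take i).count DyckStep.U : ℤ) - ((l.take i).count DyckStep.D : ℤ) =
      ((m.take i).count DyckStep.U : ℤ) - ((m.take i).count DyckStep.D : ℤ)) → l = m
  | [], [], _, _ => rfl
  | [], _ :: _, h, _ => by simp at h
  | _ :: _, [], h, _ => by simp at h
  | a :: l, b :: m, h, H => by
    have hab : a = b := by
      have h1 := H 1
      cases a <;> cases b <;> simp at h1 ⊢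
    subst hab
    congr 1
    refine list_ext_of_height l m (by simpa using h) fun i => ?_
    have h2 := H (i + 1)
    cases a <;> simp at h2 ⊢ <;> linarith

theorem length_eq (p : DyckPath n) : p.word.toList.length = 2 * n := by
  rw [← p.word.two_mul_semilength_eq_length, p.semilength_eq]

instance : PartialOrder (DyckPath n) where
  le_refl p i := le_refl _
  le_trans p q r h₁ h₂ i := (h₁ i).trans (h₂ i)
  le_antisymm p q h₁ h₂ := by
    ext1
    apply DyckWord.ext
    exact list_ext_of_height _ _ (by rw [length_eq, length_eq])
      fun i => le_antisymm (h₁ i) (h₂ i)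

end DyckPath

/-- `mod A`: the category of finitely generated right modules over the ring `A`, a right
`A`-module being a left module over the opposite ring. -/
abbrev ModFG (A : Type u) [Ring A] := FGModuleCat.{u} Aᵐᵒᵖ

/-- A torsion pair `(T, F)` of `mod A`: two full subcategories closed under isomorphisms with
`Hom(T, F) = 0` and such that every `X` is the middle term of a short exact sequence
`0 → t(X) → X → f(X) → 0` with `t(X)` in `T` and `f(X)` in `F`. -/
structure IsTorsionPair {A : Type u} [Ring A] (T F : ObjectProperty (ModFG A)) : Prop where
  closed_iso_left : T.IsClosedUnderIsomorphisms
  closed_iso_right : F.IsClosedUnderIsomorphisms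
  hom_eq_zero : ∀ X Y : ModFG A, T X → F Y → ∀ f : X ⟶ Y, f = 0
  exists_exact : ∀ X : ModFG A, ∃ (tX fX : ModFG A) (i : tX ⟶ X) (p : X ⟶ fX),
    T tX ∧ F fX ∧ Function.Injective i.hom.hom ∧ Function.Exact i.hom.hom p.hom.hom ∧
      Function.Surjective p.hom.hom

/-- The `ω_m`-torsion pairs of `mod A`: the torsion pairs `(T, F)` with `Ext^m_A(T, F) = 0`. -/
@[ext]
structure OmegaTorsionPair (A : Type u) [Ring A] (m : ℕ) where
  /-- The torsion class. -/
  T : ObjectProperty (ModFG A)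
  /-- The torsion-free class. -/
  F : ObjectProperty (ModFG A)
  isTorsionPair : IsTorsionPair T F
  ext_eq_zero : ∀ X Y : ModFG A, T X → F Y → ∀ e : Abelian.Ext X.obj Y.obj m, e = 0

/-- `(T, F) ≤ (T', F')` if and only if `T ⊆ T'` and `F' ⊆ F`. -/
instance {A : Type u} [Ring A] {m : ℕ} : PartialOrder (OmegaTorsionPair A m) where
  le x y := x.T ≤ y.T ∧ y.F ≤ x.F
  le_refl x := ⟨le_refl _, le_refl _⟩
  le_trans x y z h₁ h₂ := ⟨h₁.1.trans h₂.1, h₂.2.trans h₁.2⟩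
  le_antisymm x y h₁ h₂ :=
    OmegaTorsionPair.ext (le_antisymm h₁.1 h₂.1) (le_antisymm h₂.2 h₁.2)

/-- `Int([m])`: the nonempty intervals `[a, b]` of a chain with `m` elements, ordered by
containment. -/
abbrev IntPoset (m : ℕ) := NonemptyInterval (Fin m)

instance (m : ℕ) : Finite (IntPoset m) :=
  Finite.of_injective NonemptyInterval.toProd NonemptyInterval.toProd_injective

/-- The poset is finite, hence locally finite (needed to form its incidence algebra). -/
noncomputable instance (m : ℕ) : LocallyFiniteOrder (IntPoset m) :=
  letI := Fintype.ofFinite (IntPoset m)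
  letI : DecidableLT (IntPoset m) := Classical.decRel ((· < ·) : IntPoset m → IntPoset m → Prop)
  Fintype.toLocallyFiniteOrder

/-!
For every finite poset `P`, the `ω`-torsion pairs of right modules over the incidence algebra of `P`
are classified by the upper sets of `P`; a Dyck path of length `n`, on the other hand, is the same
thing as a lower set of intervals of a chain with `n - 1` elements.

Let `(T, F)` be a torsion pair with `Ext¹(T, F) = 0`. The long exact sequences of `Ext` show that
`T` is closed under submodules and `F` under quotients (`OmegaTorsionPair.T_of_injective`,
`OmegaTorsionPair.F_of_surjective`), so that both classes are closed under subquotients. A right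
module `M` is the direct sum of the components `M e_x`, and if `M e_x ≠ 0` then the simple module
`S_x` is a subquotient of `M` (`IncidenceAlgebra.prop_simple_of_smul_idem_ne_zero`). With
`U = {x | S_x ∈ T}`, a torsion module is therefore supported on `U` and a torsion-free one on the
complement of `U`. There are no nonzero maps from modules of the first kind to modules of the second
kind, so each class equals the class of all modules with the given support. Decomposing the regular
module shows that `U` is an upper set (`IncidenceAlgebra.isUpperSet_setOf_T_simple`).

Conversely, let `U` be an upper set, with complement `V` and idempotent `c = ∑ x ∈ V, e_x`. There is
no nonzero `a(x, y)` with `x ∈ U` and `y ∈ V`, which means that `c a c = a c` for every `a`. Hence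
the elements killed by `c` form a submodule, the torsion submodule, and `Ext¹` from a module killed
by `c` to a module fixed by `c` vanishes: a map `g` from the kernel of a free cover extends to the
cover by `p ↦ g (p c)` (`ext_eq_zero_of_mul_mul_eq`).

On the side of Dyck paths, use the numbers of down-steps and of up-steps as coordinates and let the
interval `[a, b]` stand for the lattice point `(a, b + 2)`. The intervals whose points lie weakly
below a path form a lower set, which determines the path (`DyckPath.cells_le_cells_iff`). Conversely,
the path of a lower set has, after `i` steps, the largest number of up-steps for which the endpoint is
allowed (`DyckPath.upsOf`). Both posets inherit the lattice structure of the lower sets.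
-/

/-! ### Torsion pairs with vanishing extensions -/

section Extensions

open Abelian

variable {R : Type u} [Ring R]

/-- If `Ext¹(X₃, Y) = 0`, every map `X₁ ⟶ Y` extends along `X₁ ⟶ X₂`. -/
theorem exists_extension_of_ext_eq_zero {S : ShortComplex (ModuleCat.{u} R)} (hS : S.ShortExact)
    {Y : ModuleCat.{u} R} (h : ∀ e : Ext S.X₃ Y 1, e = 0) (g : S.X₁ ⟶ Y) :
    ∃ g' : S.X₂ ⟶ Y, S.f ≫ g' = g := by
  obtain ⟨x, hx⟩ := Ext.contravariant_sequence_exact₁ hS Y (Ext.mk₀ g) (add_zero 1) (h _)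
  obtain ⟨g', rfl⟩ := (Ext.mk₀_bijective _ _).2 x
  exact ⟨g', (Ext.mk₀_bijective _ _).1 (by rw [← hx, Ext.mk₀_comp_mk₀])⟩

/-- If `Ext¹(Y, X₁) = 0`, every map `Y ⟶ X₃` lifts along `X₂ ⟶ X₃`. -/
theorem exists_lift_of_ext_eq_zero {S : ShortComplex (ModuleCat.{u} R)} (hS : S.ShortExact)
    {Y : ModuleCat.{u} R} (h : ∀ e : Ext Y S.X₁ 1, e = 0) (g : Y ⟶ S.X₃) :
    ∃ g' : Y ⟶ S.X₂, g' ≫ S.g = g := by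
  obtain ⟨x, hx⟩ := Ext.covariant_sequence_exact₃ Y hS (Ext.mk₀ g) (zero_add 1) (h _)
  obtain ⟨g', rfl⟩ := (Ext.mk₀_bijective _ _).2 x
  exact ⟨g', (Ext.mk₀_bijective _ _).1 (by rw [← hx, Ext.mk₀_comp_mk₀])⟩

/-- Dimension shifting: if `X₂` is projective and every map `X₁ ⟶ Y` extends to `X₂`, then
`Ext¹(X₃, Y) = 0`. -/
theorem ext_eq_zero_of_forall_exists_extension {S : ShortComplex (ModuleCat.{u} R)}
    (hS : S.ShortExact) [Projective S.X₂] {Y : ModuleCat.{u} R}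
    (h : ∀ g : S.X₁ ⟶ Y, ∃ g' : S.X₂ ⟶ Y, S.f ≫ g' = g) (e : Ext S.X₃ Y 1) : e = 0 := by
  obtain ⟨x, rfl⟩ := Ext.contravariant_sequence_exact₃ hS Y e (Ext.eq_zero_of_projective _)
    (add_zero 1)
  obtain ⟨g, rfl⟩ := (Ext.mk₀_bijective _ _).2 x
  obtain ⟨g', rfl⟩ := h g
  rw [← Ext.mk₀_comp_mk₀]
  exact hS.extClass_comp_assoc _

open scoped RightActions in
/-- If `c a c = a c` for all `a`, then `Ext¹(M, N) = 0` as soon as `c` kills `M` and acts as the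
identity on `N`: on a free cover of `M`, multiplication by `c` takes values in the kernel, so
that `p ↦ g (p c)` extends a map `g` from the kernel to `N`. -/
theorem ext_eq_zero_of_mul_mul_eq {A : Type u} [Ring A] {c : A} (hc : ∀ a, c * a * c = a * c)
    {M N : ModuleCat.{u} Aᵐᵒᵖ} (hM : ∀ m : M, m <• c = 0) (hN : ∀ y : N, y <• c = y)
    (e : Ext M N 1) : e = 0 := by
  have hS := M.shortExact_projectiveShortComplex
  generalize hSM : M.projectiveShortComplex = S at hS
  have : Projective S.X₂ := by
    rw [← hSM]; exact ModuleCat.projective_of_free (Module.Free.chooseBasis Aᵐᵒᵖ _)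
  obtain rfl : S.X₃ = M := by rw [← hSM]
  clear hSM
  refine ext_eq_zero_of_forall_exists_extension hS (fun g ↦ ?_) e
  have hker : ∀ p : S.X₂, ∃ q : S.X₁, S.f q = p <• c := fun p ↦
    (ShortComplex.moduleCat_exact_iff _).1 hS.exact (p <• c)
      (by rw [map_smul]; exact hM _)
  choose q hq using hker
  have hinj : Function.Injective S.f :=
    hS.moduleCat_injective_f
  refine ⟨ModuleCat.ofHom
    { toFun p := g (q p)
      map_add' p p' := by
        rw [← map_add]
        exact congrArg g (hinj (by rw [map_add, hq, hq, hq, smul_add]))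
      map_smul' a p := by
        rw [RingHom.id_apply, ← hN (a • g _), ← map_smul, ← map_smul]
        refine congrArg g (hinj ?_)
        rw [map_smul, map_smul, hq, hq]
        simp only [smul_smul]
        congr 1
        exact MulOpposite.unop_injective (by simp [← mul_assoc, hc]) }, ?_⟩
  ext k
  change g (q (S.f k)) = g k
  rw [← hN (g k), ← map_smul]
  exact congrArg g (hinj (by rw [hq, map_smul]))

end Extensions

section TorsionPairs

variable {A : Type u} [Ring A] {T F : ObjectProperty (ModFG A)}

namespace IsTorsionPair

theorem linearMap_eq_zero (h : IsTorsionPair T F) {X Y : ModFG A} (hX : T X) (hY : F Y)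
    (f : X →ₗ[Aᵐᵒᵖ] Y) : f = 0 :=
  congrArg (fun g : X ⟶ Y ↦ g.hom.hom) (h.hom_eq_zero X Y hX hY (FGModuleCat.ofHom f))

theorem left_of_linearEquiv (h : IsTorsionPair T F) {X Y : ModFG A} (hX : T X)
    (e : X ≃ₗ[Aᵐᵒᵖ] Y) : T Y :=
  have := h.closed_iso_left
  T.prop_of_iso (show X ≅ Y from e.toFGModuleCatIso) hX

theorem right_of_linearEquiv (h : IsTorsionPair T F) {X Y : ModFG A} (hX : F X)
    (e : X ≃ₗ[Aᵐᵒᵖ] Y) : F Y :=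
  have := h.closed_iso_right
  F.prop_of_iso (show X ≅ Y from e.toFGModuleCatIso) hX

theorem left_iff (h : IsTorsionPair T F) {X : ModFG A} :
    T X ↔ ∀ Y : ModFG A, F Y → ∀ f : X →ₗ[Aᵐᵒᵖ] Y, f = 0 := by
  refine ⟨fun hX Y hY f ↦ h.linearMap_eq_zero hX hY f, fun hX ↦ ?_⟩
  obtain ⟨tX, fX, i, p, ht, hf, hi, hip, -⟩ := h.exists_exact X
  refine h.left_of_linearEquiv ht (LinearEquiv.ofBijective i.hom.hom ⟨hi, fun x ↦ ?_⟩)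
  exact (hip x).1 (by rw [hX _ hf p.hom.hom, LinearMap.zero_apply])

theorem right_iff (h : IsTorsionPair T F) {Y : ModFG A} :
    F Y ↔ ∀ X : ModFG A, T X → ∀ f : X →ₗ[Aᵐᵒᵖ] Y, f = 0 := by
  refine ⟨fun hY X hX f ↦ h.linearMap_eq_zero hX hY f, fun hY ↦ ?_⟩
  obtain ⟨tY, fY, i, p, ht, hf, -, hip, hp⟩ := h.exists_exact Y
  refine h.right_of_linearEquiv hf
    (LinearEquiv.ofBijective p.hom.hom ⟨?_, hp⟩).symm
  refine (injective_iff_map_eq_zero _).2 fun y hy ↦ ?_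
  obtain ⟨x, rfl⟩ := (hip y).1 hy
  rw [hY _ ht i.hom.hom, LinearMap.zero_apply]

theorem left_of_surjective (h : IsTorsionPair T F) {X Y : ModFG A} (hX : T X)
    {f : X →ₗ[Aᵐᵒᵖ] Y} (hf : Function.Surjective f) : T Y :=
  h.left_iff.2 fun _ hZ g ↦ (LinearMap.cancel_right hf).1
    (by rw [h.linearMap_eq_zero hX hZ (g ∘ₗ f), LinearMap.zero_comp])

theorem right_of_injective (h : IsTorsionPair T F) {X Y : ModFG A} (hY : F Y)
    {f : X →ₗ[Aᵐᵒᵖ] Y} (hf : Function.Injective f) : F X :=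
  h.right_iff.2 fun _ hZ g ↦ (LinearMap.cancel_left hf).1
    (by rw [h.linearMap_eq_zero hZ hY (f ∘ₗ g), LinearMap.comp_zero])

end IsTorsionPair

namespace OmegaTorsionPair

variable (ω : OmegaTorsionPair A 1)

/-- A torsion pair with `Ext¹(T, F) = 0` is hereditary: a map from a submodule of a torsion module
`Y` to a torsion-free module extends to `Y`, hence vanishes. -/
theorem T_of_injective {X Y : ModFG A} (hY : ω.T Y) {f : X →ₗ[Aᵐᵒᵖ] Y}
    (hf : Function.Injective f) : ω.T X := by
  refine ω.isTorsionPair.left_iff.2 fun Z hZ g ↦ ?_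
  let S : ShortComplex (ModuleCat Aᵐᵒᵖ) :=
    ModuleCat.shortComplexOfCompEqZero f (LinearMap.range f).mkQ f.range_mkQ_comp
  have hS : S.ShortExact := ModuleCat.shortComplex_shortExact S
    (LinearMap.exact_map_mkQ_range f) hf (Submodule.mkQ_surjective _)
  have hQ : ω.T (FGModuleCat.of Aᵐᵒᵖ (Y ⧸ LinearMap.range f)) :=
    ω.isTorsionPair.left_of_surjective hY (f := (LinearMap.range f).mkQ)
      (Submodule.mkQ_surjective _)
  obtain ⟨g', hg'⟩ := exists_extension_of_ext_eq_zero hS (Y := Z.obj)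
    (ω.ext_eq_zero _ Z hQ hZ) (ModuleCat.ofHom g)
  have h0 : g'.hom = 0 := ω.isTorsionPair.linearMap_eq_zero hY hZ g'.hom
  have := congrArg ModuleCat.Hom.hom hg'
  rw [ModuleCat.hom_comp, h0, LinearMap.zero_comp] at this
  exact this.symm

/-- Dually, a torsion pair with `Ext¹(T, F) = 0` is cohereditary. -/
theorem F_of_surjective [IsNoetherianRing Aᵐᵒᵖ] {X Y : ModFG A} (hX : ω.F X) {f : X →ₗ[Aᵐᵒᵖ] Y}
    (hf : Function.Surjective f) : ω.F Y := by
  refine ω.isTorsionPair.right_iff.2 fun Z hZ g ↦ ?_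
  have hK : ω.F (FGModuleCat.of Aᵐᵒᵖ (LinearMap.ker f)) :=
    ω.isTorsionPair.right_of_injective hX (f := (LinearMap.ker f).subtype)
      (Submodule.injective_subtype _)
  obtain ⟨g', hg'⟩ := exists_lift_of_ext_eq_zero (LinearMap.shortExact_shortComplexKer hf)
    (Y := Z.obj) (ω.ext_eq_zero Z _ hZ hK) (ModuleCat.ofHom g)
  have h0 : g'.hom = 0 := ω.isTorsionPair.linearMap_eq_zero hZ hX g'.hom
  have := congrArg ModuleCat.Hom.hom hg'
  rw [ModuleCat.hom_comp, h0, LinearMap.comp_zero] at this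
  exact this.symm

end OmegaTorsionPair

end TorsionPairs

/-! ### Supports of modules over an incidence algebra -/

section IncidenceModules

open scoped RightActions

namespace IncidenceAlgebra

variable {k : Type u} [Field k] {P : Type*} [PartialOrder P]

open Classical in
/-- The idempotent `∑ x ∈ U, e_x` of the incidence algebra, that is, the indicator function of the
diagonal of `U × U`. -/
noncomputable def idem (k : Type u) [Field k] (U : Set P) : IncidenceAlgebra k P where
  toFun x y := if x = y ∧ x ∈ U then 1 else 0
  eq_zero_of_not_le' _ _ h := if_neg fun h' ↦ h h'.1.le

open Classical in
theorem idem_apply (U : Set P) (x y : P) :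
    idem k U x y = if x = y ∧ x ∈ U then 1 else 0 := rfl

theorem idem_insert {x : P} {U : Set P} (hx : x ∉ U) :
    idem k (insert x U) = idem k {x} + idem k U := by
  ext y z -
  simp only [idem_apply, add_apply, Set.mem_insert_iff, Set.mem_singleton_iff]
  grind

theorem idem_empty : idem k (∅ : Set P) = 0 := by
  ext x y -
  simp [idem_apply, zero_apply]

theorem idem_add_idem_compl [DecidableEq P] (U : Set P) : idem k U + idem k Uᶜ = 1 := by
  ext x y -
  simp only [idem_apply, add_apply, one_apply, Set.mem_compl_iff]
  grind

variable [LocallyFiniteOrder P]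

open Classical in
theorem mul_idem_apply (f : IncidenceAlgebra k P) (U : Set P) (x y : P) :
    (f * idem k U) x y = if y ∈ U then f x y else 0 := by
  by_cases hxy : x ≤ y
  · rw [mul_apply, Finset.sum_eq_single y]
    · simp [idem_apply]
    · intro z _ hz; simp [idem_apply, hz]
    · intro h; exact absurd (Finset.mem_Icc.2 ⟨hxy, le_rfl⟩) h
  · simp [apply_eq_zero_of_not_le hxy]

open Classical in
theorem idem_mul_apply (f : IncidenceAlgebra k P) (U : Set P) (x y : P) :
    (idem k U * f) x y = if x ∈ U then f x y else 0 := by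
  by_cases hxy : x ≤ y
  · rw [mul_apply, Finset.sum_eq_single x]
    · simp [idem_apply]
    · intro z _ hz; simp [idem_apply, hz.symm]
    · intro h; exact absurd (Finset.mem_Icc.2 ⟨le_rfl, hxy⟩) h
  · simp [apply_eq_zero_of_not_le hxy]

theorem idem_mul_idem (U V : Set P) : idem k U * idem k V = idem k (U ∩ V) := by
  ext x y -
  rw [idem_mul_apply]
  simp only [idem_apply, Set.mem_inter_iff]
  grind

theorem idem_compl_mul_mul {U : Set P} (hU : IsUpperSet U) (a : IncidenceAlgebra k P) :
    idem k Uᶜ * a * idem k Uᶜ = a * idem k Uᶜ := by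
  ext x y hxy
  simp only [mul_idem_apply, idem_mul_apply, Set.mem_compl_iff]
  have := @hU x y hxy
  grind

variable [DecidableEq P]

instance isNoetherianRing_mulOpposite [Finite P] : IsNoetherianRing (IncidenceAlgebra k P)ᵐᵒᵖ := by
  let φ : IncidenceAlgebra k P →ₗ[k] (P → P → k) :=
    { toFun f := f, map_add' _ _ := rfl, map_smul' _ _ := rfl }
  have : Module.Finite k (IncidenceAlgebra k P) :=
    Module.Finite.of_injective φ DFunLike.coe_injective
  exact isNoetherian_of_tower k inferInstance

section Module

variable {M : Type*} [AddCommGroup M] [Module (IncidenceAlgebra k P)ᵐᵒᵖ M]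

theorem smul_idem_add_smul_idem_compl (m : M) (U : Set P) :
    m <• idem k U + m <• idem k Uᶜ = m := by
  rw [← add_smul, ← MulOpposite.op_add, idem_add_idem_compl, MulOpposite.op_one, one_smul]

theorem smul_idem_eq_zero [Finite P] {m : M} {U : Set P} (h : ∀ x ∈ U, m <• idem k {x} = 0) :
    m <• idem k U = 0 := by
  induction U, U.toFinite using Set.Finite.induction_on with
  | empty => rw [idem_empty, MulOpposite.op_zero, zero_smul]
  | @insert x U hx _ ih =>
    rw [idem_insert hx, MulOpposite.op_add, add_smul, h x (Set.mem_insert _ _),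
      ih fun y hy ↦ h y (Set.mem_insert_of_mem _ hy), add_zero]

variable (k M) in
/-- The largest submodule of `M` supported on the upper set `U`. -/
def supportedSubmodule {U : Set P} (hU : IsUpperSet U) :
    Submodule (IncidenceAlgebra k P)ᵐᵒᵖ M where
  carrier := {m | m <• idem k Uᶜ = 0}
  zero_mem' := smul_zero _
  add_mem' {m m'} h h' := by rw [Set.mem_ofPred_eq] at *; rw [smul_add, h, h', add_zero]
  smul_mem' a m h := by
    obtain ⟨a, rfl⟩ := MulOpposite.op_surjective a
    rw [Set.mem_ofPred_eq] at *
    rw [op_smul_op_smul, ← idem_compl_mul_mul hU, op_smul_mul, op_smul_mul, h, smul_zero,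
      smul_zero]

theorem mem_supportedSubmodule {U : Set P} {hU : IsUpperSet U} {m : M} :
    m ∈ supportedSubmodule k M hU ↔ m <• idem k Uᶜ = 0 := Iff.rfl

end Module

/-- The finitely generated right modules supported on `U`: those with `M e_x = 0` for `x ∉ U`. -/
def SupportedOn (k : Type u) [Field k] {P : Type} [PartialOrder P] [LocallyFiniteOrder P]
    [DecidableEq P] (U : Set P) : ObjectProperty (ModFG (IncidenceAlgebra k P)) :=
  fun M ↦ ∀ m : M, m <• idem k Uᶜ = 0

section Supported

variable {P : Type} [PartialOrder P] [LocallyFiniteOrder P] [DecidableEq P]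
  {U V : Set P} {M N : ModFG (IncidenceAlgebra k P)}

theorem SupportedOn.mono (h : U ⊆ V) : SupportedOn k U ≤ SupportedOn k V := fun M hM m ↦ by
  rw [← Set.inter_eq_right.2 (Set.compl_subset_compl.2 h), ← idem_mul_idem, op_smul_mul, hM,
    smul_zero]

theorem SupportedOn.smul_idem (hM : SupportedOn k U M) (m : M) : m <• idem k U = m := by
  have := smul_idem_add_smul_idem_compl (k := k) m U
  rwa [hM, add_zero] at this

theorem SupportedOn.linearMap_eq_zero (hM : SupportedOn k U M) (hN : SupportedOn k Uᶜ N)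
    (f : M →ₗ[(IncidenceAlgebra k P)ᵐᵒᵖ] N) : f = 0 := by
  ext m
  rw [← hM.smul_idem m, map_smul, LinearMap.zero_apply]
  simpa using hN (f m)

instance : (SupportedOn k U).IsClosedUnderIsomorphisms where
  of_iso {M N} e hM n := by
    let e' : M ≃ₗ[_] N := FGModuleCat.isoToLinearEquiv e
    rw [← e'.apply_symm_apply n, ← map_smul, hM, map_zero]

end Supported

/-! ### Simple modules -/

section Simple

variable {P : Type} [PartialOrder P] [LocallyFiniteOrder P] [DecidableEq P]

/-- The evaluation `a ↦ a(x, x)`, as a ring homomorphism from the opposite algebra to the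
field. -/
def diagEval (k : Type u) [Field k] (x : P) : (IncidenceAlgebra k P)ᵐᵒᵖ →+* k where
  toFun a := a.unop x x
  map_one' := by simp
  map_mul' a b := by simp [mul_comm]
  map_zero' := rfl
  map_add' _ _ := rfl

/-- The simple right module `S_x` at the vertex `x`: the field `k`, on which `a` acts as the
scalar `a(x, x)`. -/
def simple (k : Type u) [Field k] (x : P) : ModFG (IncidenceAlgebra k P) :=
  letI := Module.compHom k (diagEval k x)
  haveI : Module.Finite (IncidenceAlgebra k P)ᵐᵒᵖ k :=
    .of_surjective (LinearMap.toSpanSingleton (IncidenceAlgebra k P)ᵐᵒᵖ k 1) fun c ↦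
      ⟨MulOpposite.op (c • 1), by
        change (c • (1 : IncidenceAlgebra k P)) x x * 1 = c
        rw [constSMul_apply, one_apply, if_pos rfl, smul_eq_mul, mul_one, mul_one]⟩
  FGModuleCat.of (IncidenceAlgebra k P)ᵐᵒᵖ k

theorem simple_smul (x : P) (a : IncidenceAlgebra k P) (c : k) :
    HSMul.hSMul (β := simple k x) (MulOpposite.op a) c = a x x * c := rfl

theorem supportedOn_simple_iff {x : P} {U : Set P} : SupportedOn k U (simple k x) ↔ x ∈ U := by
  classical
  have key (c : k) : HSMul.hSMul (β := simple k x) (MulOpposite.op (idem k Uᶜ)) c =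
      if x ∈ U then (0 : k) else c := by
    rw [simple_smul, idem_apply]
    by_cases hx : x ∈ U <;> simp [hx] <;> rfl
  refine ⟨fun h ↦ ?_, fun h c ↦ (key c).trans (if_pos h)⟩
  by_contra hx
  exact one_ne_zero (α := k) (((if_neg hx).symm.trans (key 1).symm).trans (h (1 : k)))

theorem smul_idem_singleton_sub_mul (x : P) (a : IncidenceAlgebra k P) (c : k) :
    ((a x x * c) • idem k {x} - (c • idem k {x}) * a) * idem k (Set.Ioi x)ᶜ = 0 := by
  classical
  ext y z hyz
  rw [mul_idem_apply, sub_apply, smul_mul_assoc, constSMul_apply, constSMul_apply, idem_mul_apply,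
    idem_apply, zero_apply]
  simp only [Set.mem_compl_iff, Set.mem_Ioi, Set.mem_singleton_iff, smul_eq_mul]
  by_cases hy : y = x
  · subst hy
    rcases hyz.eq_or_lt with rfl | h
    · simp [mul_comm]
    · simp [h]
  · simp [hy]

/-- If `M e_x ≠ 0`, then `S_x` is a subquotient of `M`: a nonzero element of `M e_x` spans a copy
of `S_x` modulo the elements of `M` that are supported strictly above `x`. -/
theorem prop_simple_of_smul_idem_ne_zero {C : ObjectProperty (ModFG (IncidenceAlgebra k P))}
    (hsub : ∀ {X Y : ModFG (IncidenceAlgebra k P)}, C Y →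
      ∀ {f : X →ₗ[(IncidenceAlgebra k P)ᵐᵒᵖ] Y}, Function.Injective f → C X)
    (hquot : ∀ {X Y : ModFG (IncidenceAlgebra k P)}, C X →
      ∀ {f : X →ₗ[(IncidenceAlgebra k P)ᵐᵒᵖ] Y}, Function.Surjective f → C Y)
    {M : ModFG (IncidenceAlgebra k P)} (hM : C M) {x : P} {m : M} (hm : m <• idem k {x} ≠ 0) :
    C (simple k x) := by
  let N := supportedSubmodule k M (isUpperSet_Ioi x)
  have hQ : C (FGModuleCat.of _ (M ⧸ N)) := hquot hM (f := N.mkQ) N.mkQ_surjective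
  let f : simple k x →ₗ[(IncidenceAlgebra k P)ᵐᵒᵖ] M ⧸ N :=
    { toFun (c : k) := N.mkQ (m <• (c • idem k {x}))
      map_add' (c d : k) := by
        rw [← map_add, ← add_smul, ← MulOpposite.op_add, ← add_smul]
        rfl
      map_smul' a (c : k) := by
        obtain ⟨a, rfl⟩ := MulOpposite.op_surjective a
        rw [RingHom.id_apply, ← map_smul, op_smul_op_smul, ← sub_eq_zero, ← map_sub, ← sub_smul,
          ← MulOpposite.op_sub, Submodule.mkQ_apply, Submodule.Quotient.mk_eq_zero,
          mem_supportedSubmodule, op_smul_op_smul, simple_smul, smul_idem_singleton_sub_mul,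
          MulOpposite.op_zero, zero_smul] }
  refine hsub hQ (f := f) ((injective_iff_map_eq_zero _).2 fun (c : k) hc ↦ ?_)
  by_contra hc0
  refine hm ?_
  have h : m <• (c • idem k {x}) = 0 := by
    have h' : m <• (c • idem k {x}) <• idem k (Set.Ioi x)ᶜ = 0 :=
      (Submodule.Quotient.mk_eq_zero N).1 hc
    rwa [op_smul_op_smul, smul_mul_assoc, idem_mul_idem, Set.inter_eq_left.2 (by simp)] at h'
  have h' : m <• (c • idem k {x}) <• (c⁻¹ • (1 : IncidenceAlgebra k P)) = _ :=
    congrArg (· <• (c⁻¹ • (1 : IncidenceAlgebra k P))) h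
  rw [op_smul_op_smul, smul_zero, mul_smul_comm, mul_one, smul_smul] at h'
  rwa [inv_mul_cancel₀ hc0, one_smul] at h'

end Simple

end IncidenceAlgebra

end IncidenceModules

/-! ### The torsion pairs of an incidence algebra -/

section Classification

open scoped RightActions

namespace IncidenceAlgebra

variable {k : Type u} [Field k] {P : Type} [PartialOrder P] [LocallyFiniteOrder P]
  [DecidableEq P] [Finite P]

/-- The torsion pair of an upper set `U`: the modules supported on `U` and those supported on its
complement. -/
def torsionPairOfUpperSet (k : Type u) [Field k] (U : UpperSet P) :
    OmegaTorsionPair (IncidenceAlgebra k P) 1 where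
  T := SupportedOn k U
  F := SupportedOn k Uᶜ
  isTorsionPair :=
    { closed_iso_left := inferInstance
      closed_iso_right := inferInstance
      hom_eq_zero X Y hX hY f := FGModuleCat.hom_ext (hX.linearMap_eq_zero hY f.hom.hom)
      exists_exact X := by
        let N := supportedSubmodule k X U.upper
        refine ⟨FGModuleCat.of _ N, FGModuleCat.of _ (X ⧸ N), FGModuleCat.ofHom N.subtype,
          FGModuleCat.ofHom N.mkQ, fun m ↦ Subtype.ext m.2, fun y ↦ ?_, N.injective_subtype,
          LinearMap.exact_subtype_mkQ N, N.mkQ_surjective⟩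
        obtain ⟨m, rfl⟩ := N.mkQ_surjective y
        rw [← map_smul, Submodule.mkQ_apply, Submodule.Quotient.mk_eq_zero,
          mem_supportedSubmodule, op_smul_op_smul, idem_mul_idem, compl_compl, Set.inter_compl_self,
          idem_empty, MulOpposite.op_zero, zero_smul] }
  ext_eq_zero _ _ hX hY := ext_eq_zero_of_mul_mul_eq (idem_compl_mul_mul U.upper) hX hY.smul_idem

variable (ω : OmegaTorsionPair (IncidenceAlgebra k P) 1)

theorem T_le_supportedOn : ω.T ≤ SupportedOn k {x | ω.T (simple k x)} := fun _ hM _ ↦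
  smul_idem_eq_zero fun _ hx ↦ by_contra fun h ↦
    hx (prop_simple_of_smul_idem_ne_zero ω.T_of_injective
      ω.isTorsionPair.left_of_surjective hM h)

theorem F_le_supportedOn : ω.F ≤ SupportedOn k {x | ω.T (simple k x)}ᶜ := fun _ hM _ ↦
  smul_idem_eq_zero fun x hx ↦ by_contra fun h ↦ by
    have hF : ω.F (simple k x) := prop_simple_of_smul_idem_ne_zero
      ω.isTorsionPair.right_of_injective ω.F_of_surjective hM h
    rw [compl_compl] at hx
    have h0 := ω.isTorsionPair.linearMap_eq_zero hx hF LinearMap.id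
    exact one_ne_zero (α := k) (congrArg (fun f ↦ f (1 : k)) h0)

theorem T_eq_supportedOn : ω.T = SupportedOn k {x | ω.T (simple k x)} :=
  le_antisymm (T_le_supportedOn ω) fun _ hM ↦ ω.isTorsionPair.left_iff.2 fun _ hY f ↦
    hM.linearMap_eq_zero (F_le_supportedOn ω _ hY) f

theorem F_eq_supportedOn : ω.F = SupportedOn k {x | ω.T (simple k x)}ᶜ :=
  le_antisymm (F_le_supportedOn ω) fun _ hM ↦ ω.isTorsionPair.right_iff.2 fun _ hX f ↦
    (T_le_supportedOn ω _ hX).linearMap_eq_zero hM f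

/-- If `S_x` is torsion, then the image of `e_x` in the torsion-free quotient of the regular module
vanishes, so that `e_x` lies in the torsion submodule. For `x ≤ y` the torsion submodule then has an
element with nonzero component at `y`, namely `e_x ζ`. -/
theorem isUpperSet_setOf_T_simple : IsUpperSet {x | ω.T (simple k x)} := by
  classical
  intro x y hxy hx
  by_contra hy
  obtain ⟨tX, fX, i, p, ht, hf, -, hip, -⟩ := ω.isTorsionPair.exists_exact
    (FGModuleCat.of (IncidenceAlgebra k P)ᵐᵒᵖ (IncidenceAlgebra k P)ᵐᵒᵖ)
  have hmul (U V : Set P) : MulOpposite.op (idem k U) <• idem k V =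
      MulOpposite.op (idem k (U ∩ V)) := by
    rw [← idem_mul_idem]
    rfl
  obtain ⟨w, hw⟩ := (hip (MulOpposite.op (idem k {x}))).1 (by
    have h : p.hom.hom (MulOpposite.op (idem k {x}) <• idem k {x | ω.T (simple k x)}) = 0 := by
      rw [map_smul]
      simpa using F_le_supportedOn ω _ hf (p.hom.hom (MulOpposite.op (idem k {x})))
    rwa [hmul, Set.inter_eq_left.2 (Set.singleton_subset_iff.2 hx)] at h)
  have h := congrArg i.hom.hom (T_le_supportedOn ω _ ht (w <• (zeta k : IncidenceAlgebra k P)))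
  rw [map_smul, map_smul, hw, map_zero] at h
  have h' : idem k {x} * zeta k * idem k {x | ω.T (simple k x)}ᶜ = 0 :=
    MulOpposite.op_injective h
  have h'' := congrArg (fun f : IncidenceAlgebra k P ↦ f x y) h'
  rw [mul_idem_apply, if_pos (Set.mem_compl hy), idem_mul_apply, if_pos (Set.mem_singleton x),
    zeta_of_le hxy] at h''
  exact one_ne_zero h''

/-- The `ω`-torsion pairs of an incidence algebra correspond to the upper sets of the poset. The
order on `UpperSet P` is reverse inclusion, whence the order dual. -/
noncomputable def upperSetOrderIso (k : Type u) [Field k] (P : Type) [PartialOrder P]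
    [LocallyFiniteOrder P] [DecidableEq P] [Finite P] :
    (UpperSet P)ᵒᵈ ≃o OmegaTorsionPair (IncidenceAlgebra k P) 1 where
  toFun U := torsionPairOfUpperSet k (OrderDual.ofDual U)
  invFun ω := OrderDual.toDual ⟨_, isUpperSet_setOf_T_simple ω⟩
  left_inv U := congrArg OrderDual.toDual (UpperSet.ext (Set.ext fun _ ↦ supportedOn_simple_iff))
  right_inv ω := OmegaTorsionPair.ext (T_eq_supportedOn ω).symm (F_eq_supportedOn ω).symm
  map_rel_iff' {U V} := by
    refine ⟨fun h x hx ↦ supportedOn_simple_iff.1 (h.1 _ (supportedOn_simple_iff.2 hx)),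
      fun h ↦ ⟨SupportedOn.mono h, SupportedOn.mono (Set.compl_subset_compl.2 h)⟩⟩

end IncidenceAlgebra

end Classification

/-! ### Dyck paths as lower sets of intervals -/

namespace DyckPath

variable {n : ℕ}

/-- The number of up-steps among the first `i` steps of a Dyck path. -/
def ups (p : DyckPath n) (i : ℕ) : ℕ := (p.word.toList.take i).count DyckStep.U

theorem count_U_add_count_D (l : List DyckStep) :
    l.count DyckStep.U + l.count DyckStep.D = l.length := by
  induction l with
  | nil => rfl
  | cons a l ih => cases a <;> simp <;> omega

theorem height_eq (p : DyckPath n) {i : ℕ} (hi : i ≤ 2 * n) : p.height i = 2 * p.ups i - i := by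
  have h := count_U_add_count_D (p.word.toList.take i)
  rw [List.length_take, p.length_eq, min_eq_left hi] at h
  rw [height, ups]
  omega

theorem le_two_mul_ups (p : DyckPath n) {i : ℕ} (hi : i ≤ 2 * n) : i ≤ 2 * p.ups i := by
  have h := count_U_add_count_D (p.word.toList.take i)
  have h' := p.word.count_D_le_count_U i
  rw [List.length_take, p.length_eq, min_eq_left hi] at h
  rw [ups]
  omega

theorem ups_succ (p : DyckPath n) (i : ℕ) :
    p.ups i ≤ p.ups (i + 1) ∧ p.ups (i + 1) ≤ p.ups i + 1 := by
  rw [ups, ups, List.take_add_one, List.count_append]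
  have := List.count_le_length (a := DyckStep.U) (l := p.word.toList[i]?.toList)
  have h : (p.word.toList[i]?.toList).length ≤ 1 := by cases p.word.toList[i]? <;> simp
  omega

theorem ups_add (p : DyckPath n) (i j : ℕ) :
    p.ups i ≤ p.ups (i + j) ∧ p.ups (i + j) ≤ p.ups i + j := by
  induction j with
  | zero => simp
  | succ j ih => have := p.ups_succ (i + j); rw [← add_assoc]; omega

theorem ups_le_self (p : DyckPath n) (i : ℕ) : p.ups i ≤ i :=
  List.count_le_length.trans (List.length_take_le _ _)

theorem ups_le (p : DyckPath n) (i : ℕ) : p.ups i ≤ n :=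
  ((List.take_sublist _ _).count_le _).trans_eq p.semilength_eq

theorem le_iff_ups_le {p q : DyckPath n} : p ≤ q ↔ ∀ i ≤ 2 * n, p.ups i ≤ q.ups i := by
  refine ⟨fun h i hi ↦ ?_, fun h i ↦ ?_⟩
  · have := h i
    rw [height_eq p hi, height_eq q hi] at this
    omega
  · rcases le_total i (2 * n) with hi | hi
    · have := h i hi
      rw [height_eq p hi, height_eq q hi]
      omega
    · rw [height, height, List.take_of_length_le (p.length_eq.trans_le hi),
        List.take_of_length_le (q.length_eq.trans_le hi), p.word.count_U_eq_count_D,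
        q.word.count_U_eq_count_D, sub_self, sub_self]

/-- The lower set of intervals of a Dyck path. In the coordinates `(number of down-steps, number of
up-steps)`, the interval `[a, b]` belongs to it if and only if the lattice point `(a, b + 2)` lies
weakly below the path; these are the points at height at least `2`. -/
def cells (p : DyckPath n) : LowerSet (IntPoset (n - 1)) where
  carrier := {I | (I.snd : ℕ) + 2 ≤ p.ups (I.fst + I.snd + 2)}
  lower' := by
    intro I J hJ hI
    have hI' : (I.snd : ℕ) + 2 ≤ p.ups (I.fst + I.snd + 2) := hI
    change (J.snd : ℕ) + 2 ≤ p.ups (J.fst + J.snd + 2)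
    have h₁ : (I.fst : ℕ) ≤ J.fst := (NonemptyInterval.le_def.1 hJ).1
    have h₂ : (J.snd : ℕ) ≤ I.snd := (NonemptyInterval.le_def.1 hJ).2
    have h₃ := p.ups_add (I.fst + J.snd + 2) (I.snd - J.snd)
    have h₄ := p.ups_add (I.fst + J.snd + 2) (J.fst - I.fst)
    rw [show (I.fst : ℕ) + J.snd + 2 + (I.snd - J.snd) = I.fst + I.snd + 2 by omega] at h₃
    rw [show (I.fst : ℕ) + J.snd + 2 + (J.fst - I.fst) = J.fst + J.snd + 2 by omega] at h₄
    omega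

theorem mem_cells {p : DyckPath n} {I : IntPoset (n - 1)} :
    I ∈ p.cells ↔ (I.snd : ℕ) + 2 ≤ p.ups (I.fst + I.snd + 2) := Iff.rfl

theorem cells_le_cells_iff {p q : DyckPath n} : p.cells ≤ q.cells ↔ p ≤ q := by
  rw [le_iff_ups_le]
  refine ⟨fun h i hi ↦ ?_, fun h I hI ↦ ?_⟩
  · have hq := q.le_two_mul_ups hi
    have hpi := p.ups_le_self i
    have hpn := p.ups_le i
    -- At heights at most `1` there is no interval, but the bound holds for every Dyck path.
    by_cases hp : 2 * p.ups i ≤ i + 1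
    · omega
    · let I : IntPoset (n - 1) :=
        ⟨(⟨i - p.ups i, by omega⟩, ⟨p.ups i - 2, by omega⟩), Fin.mk_le_mk.2 (by omega)⟩
      have hi' : i - p.ups i + (p.ups i - 2) + 2 = i := by omega
      have hI : I ∈ p.cells := by
        change p.ups i - 2 + 2 ≤ p.ups (i - p.ups i + (p.ups i - 2) + 2)
        rw [hi']
        omega
      have hI' : p.ups i - 2 + 2 ≤ q.ups (i - p.ups i + (p.ups i - 2) + 2) := h hI
      rw [hi'] at hI'
      omega
  · exact (mem_cells.1 hI).trans (h _ (by have := I.fst.isLt; have := I.snd.isLt; omega))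

/-- The word of length `m` with an up-step wherever `s` increases. If `s` starts at `0` and grows by
at most `1` at a time, then `s i` is its number of up-steps among the first `i` steps. -/
def stepList (s : ℕ → ℕ) (m : ℕ) : List DyckStep :=
  (List.range m).map fun i ↦ if s (i + 1) = s i then DyckStep.D else DyckStep.U

theorem count_U_stepList {s : ℕ → ℕ} (h0 : s 0 = 0)
    (hs : ∀ i, s i ≤ s (i + 1) ∧ s (i + 1) ≤ s i + 1) (m : ℕ) :
    (stepList s m).count DyckStep.U = s m := by
  induction m with
  | zero => simp [stepList, h0]
  | succ m ih =>
    rw [stepList, List.range_succ, List.map_append, List.count_append, ← stepList, ih]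
    have := hs m
    by_cases h : s (m + 1) = s m
    · simp [h]
    · simp [h]; omega

theorem take_stepList (s : ℕ → ℕ) {i m : ℕ} (hi : i ≤ m) :
    (stepList s m).take i = stepList s i := by
  rw [stepList, ← List.map_take, List.take_range, min_eq_left hi, stepList]

theorem exists_ups_eq {s : ℕ → ℕ} (h0 : s 0 = 0)
    (hs : ∀ i, s i ≤ s (i + 1) ∧ s (i + 1) ≤ s i + 1) (hn : s (2 * n) = n)
    (hle : ∀ i, i ≤ 2 * s i) : ∃ p : DyckPath n, ∀ i ≤ 2 * n, p.ups i = s i := by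
  have hlen (m : ℕ) : (stepList s m).length = m := by simp [stepList]
  have hD (m : ℕ) : s m + (stepList s m).count DyckStep.D = m := by
    have := count_U_add_count_D (stepList s m)
    rwa [hlen, count_U_stepList h0 hs] at this
  have hcount : (stepList s (2 * n)).count DyckStep.U = (stepList s (2 * n)).count DyckStep.D := by
    have := hD (2 * n)
    rw [count_U_stepList h0 hs]
    omega
  refine ⟨⟨⟨stepList s (2 * n), hcount, fun i ↦ ?_⟩, (count_U_stepList h0 hs _).trans hn⟩,
    fun i hi ↦ ?_⟩
  · rcases le_total i (2 * n) with hi | hi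
    · have := hD i
      have := hle i
      rw [take_stepList s hi, count_U_stepList h0 hs]
      omega
    · rw [List.take_of_length_le ((hlen _).trans_le hi), hcount]
  · change ((stepList s (2 * n)).take i).count DyckStep.U = s i
    rw [take_stepList s hi, count_U_stepList h0 hs]

section OfLowerSet

variable {m : ℕ} (U : LowerSet (IntPoset m))

/-- The lattice point `(x, y)` lies weakly below the path of the lower set `U`. -/
def Below (x y : ℕ) : Prop := y ≤ x + 1 ∨ ∃ I ∈ U, (I.fst : ℕ) = x ∧ (I.snd : ℕ) + 2 = y

variable {U}

theorem Below.mono {x y x' y' : ℕ} (h : Below U x y) (hx : x ≤ x') (hy : y' ≤ y) :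
    Below U x' y' := by
  by_cases hxy : y' ≤ x' + 1
  · exact .inl hxy
  · obtain h | ⟨I, hI, rfl, rfl⟩ := h
    · omega
    · have hI2 := I.snd.isLt
      refine .inr ⟨⟨(⟨x', by omega⟩, ⟨y' - 2, by omega⟩), Fin.mk_le_mk.2 (by omega)⟩,
        U.lower (NonemptyInterval.le_def.2 ⟨?_, ?_⟩) hI, rfl, ?_⟩
      · exact Fin.mk_le_mk.2 hx
      · change y' - 2 ≤ (I.snd : ℕ)
        omega
      · change y' - 2 + 2 = y'
        omega

open Classical in
variable (U) in
/-- The number of up-steps among the first `i` steps of the path of the lower set `U`. -/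
noncomputable def upsOf (i : ℕ) : ℕ :=
  Nat.findGreatest (fun y ↦ Below U (i - y) y) i

open Classical in
theorem upsOf_le_self (i : ℕ) : upsOf U i ≤ i := Nat.findGreatest_le i

open Classical in
theorem below_upsOf (i : ℕ) : Below U (i - upsOf U i) (upsOf U i) :=
  Nat.findGreatest_spec (P := fun y ↦ Below U (i - y) y) (Nat.zero_le i) (.inl (Nat.zero_le _))

open Classical in
theorem le_upsOf_iff {i y : ℕ} (hy : y ≤ i) : y ≤ upsOf U i ↔ Below U (i - y) y :=
  ⟨fun h ↦ (below_upsOf i).mono (by omega) h, fun h ↦ Nat.le_findGreatest hy h⟩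

theorem upsOf_succ (i : ℕ) : upsOf U i ≤ upsOf U (i + 1) ∧ upsOf U (i + 1) ≤ upsOf U i + 1 := by
  have h := upsOf_le_self (U := U) i
  have h' := upsOf_le_self (U := U) (i + 1)
  refine ⟨(le_upsOf_iff (by omega)).2 ((below_upsOf i).mono (by omega) le_rfl), ?_⟩
  rcases Nat.eq_zero_or_pos (upsOf U (i + 1)) with h0 | hpos
  · omega
  rw [← Nat.sub_le_iff_le_add]
  exact (le_upsOf_iff (by omega)).2 ((below_upsOf (i + 1)).mono (by omega) (by omega))

theorem le_two_mul_upsOf (i : ℕ) : i ≤ 2 * upsOf U i := by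
  have : (i + 1) / 2 ≤ upsOf U i := (le_upsOf_iff (by omega)).2 (.inl (by omega))
  omega

theorem upsOf_two_mul : upsOf U (2 * (m + 1)) = m + 1 := by
  have h := le_two_mul_upsOf (U := U) (2 * (m + 1))
  refine le_antisymm ?_ (by omega)
  obtain h' | ⟨I, -, -, hI⟩ := below_upsOf (U := U) (2 * (m + 1))
  · omega
  · have := I.snd.isLt
    omega

end OfLowerSet

theorem cells_surjective (hn : 1 ≤ n) : Function.Surjective (cells (n := n)) := by
  obtain ⟨m, rfl⟩ : ∃ m, n = m + 1 := ⟨n - 1, by omega⟩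
  intro (U : LowerSet (IntPoset m))
  obtain ⟨p, hp⟩ := exists_ups_eq (Nat.le_zero.1 (upsOf_le_self (U := U) 0)) upsOf_succ
    upsOf_two_mul le_two_mul_upsOf
  refine ⟨p, SetLike.ext fun (I : IntPoset m) ↦ ?_⟩
  have h₁ := I.fst.isLt
  have h₂ := I.snd.isLt
  have h₃ : (I.fst : ℕ) ≤ I.snd := I.fst_le_snd
  change (I.snd : ℕ) + 2 ≤ p.ups (I.fst + I.snd + 2) ↔ I ∈ U
  rw [hp _ (by omega), le_upsOf_iff (by omega),
    show (I.fst : ℕ) + I.snd + 2 - (I.snd + 2) = I.fst by omega]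
  refine ⟨fun h ↦ ?_, fun h ↦ .inr ⟨I, h, rfl, rfl⟩⟩
  obtain h | ⟨J, hJ, hJ₁, hJ₂⟩ := h
  · omega
  · rwa [show I = J from NonemptyInterval.ext (Prod.ext (Fin.ext hJ₁.symm) (Fin.ext (by omega)))]

/-- Dyck paths of length `n`, ordered by lying below one another, are the lower sets of intervals of
a chain with `n - 1` elements. -/
noncomputable def lowerSetOrderIso (hn : 1 ≤ n) : DyckPath n ≃o LowerSet (IntPoset (n - 1)) :=
  RelIso.ofSurjective (OrderEmbedding.ofMapLEIff cells fun _ _ ↦ cells_le_cells_iff)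
    (cells_surjective hn)

end DyckPath

/-! ### The isomorphism -/

/-- Lower sets of `α`, ordered by inclusion, are upper sets of the dual of `α`, ordered by inclusion
(and `UpperSet` is ordered by reverse inclusion). -/
def lowerSetOrderIsoUpperSetDual (α : Type*) [LE α] : LowerSet α ≃o (UpperSet αᵒᵈ)ᵒᵈ where
  toFun U := OrderDual.toDual ⟨OrderDual.ofDual ⁻¹' U, fun _ _ h hx ↦ U.lower h hx⟩
  invFun V := ⟨OrderDual.toDual ⁻¹' (OrderDual.ofDual V : UpperSet αᵒᵈ),
    fun _ _ h hx ↦ (OrderDual.ofDual V).upper h hx⟩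
  left_inv _ := rfl
  right_inv _ := rfl
  map_rel_iff' := Iff.rfl

theorem IsLatticeOrder.of_orderIso {α β : Type*} [PartialOrder α] [Lattice β] (e : α ≃o β) :
    IsLatticeOrder α := fun x y ↦ by
  refine ⟨⟨e.symm (e x ⊔ e y), ?_⟩, e.symm (e x ⊓ e y), ?_⟩
  · rw [← e.isLUB_image']; simpa [Set.image_pair] using isLUB_pair
  · rw [← e.isGLB_image']; simpa [Set.image_pair] using isGLB_pair

theorem theorem1 (k : Type u) [Field k] (n : ℕ) (hn : 1 ≤ n) :
    IsLatticeOrder (DyckPath n) ∧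
    IsLatticeOrder (OmegaTorsionPair (IncidenceAlgebra k (IntPoset (n - 1))ᵒᵈ) 1) ∧
    Nonempty (DyckPath n ≃o OmegaTorsionPair (IncidenceAlgebra k (IntPoset (n - 1))ᵒᵈ) 1) := by
  let e := (DyckPath.lowerSetOrderIso hn).trans ((lowerSetOrderIsoUpperSetDual _).trans
    (IncidenceAlgebra.upperSetOrderIso k (IntPoset (n - 1))ᵒᵈ))
  exact ⟨.of_orderIso (DyckPath.lowerSetOrderIso hn),
    .of_orderIso (e.symm.trans (DyckPath.lowerSetOrderIso hn)), ⟨e⟩⟩
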